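/- Let $X_1,X_2,\dots$ be i.i.d. real random variables with continuous distribution function $F$, and put $R(x)=-\log(1-F(x))\in[0,\infty]$ (with $R(x)=\infty$ if $F(x)=1$). For $1\le r\le n$ let $M^{(r)}_n$ be the $r$th largest of $X_1,\dots,X_n$. For $\gamma\in\mathbb R$ let $\mathrm{supp}_\gamma=\{x\in\mathbb R:1-\gamma x>0\}$ and, for $x\in\mathrm{supp}_\gamma$, let $g_\gamma(x)=(1-\gamma x)^{-1/\gamma}$ if $\gamma\ne0$ and $g_0(x)=e^x$; let $g_\gamma^{\leftarrow}:(0,\infty)\to\mathrm{supp}_\gamma$ be the inverse of the bijection $g_\gamma:\mathrm{supp}_\gamma\to(0,\infty)$, that is, $g_\gamma^{\leftarrow}(y)=(1-y^{-\gamma})/\gamma$ if $\gamma\neq 0$ and $g_0^{\leftarrow}(y)=\log y$. Suppose that for some $\gamma\in\mathbb R$, $a_r>0$ and $b_r\in\mathbb R$ ($r\ge1$), $$ r\,R(a_r x-b_r)\to g_\gamma(x)\quad (r\to\infty)\qquad\text{for every } x\in\mathrm{supp}_\gamma. $$ Then, as $r\to\infty$, $$\Bigl(\frac{M^{(r)}_{r+j}+b_r}{a_r},\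 j\ge0\Bigr)\Rightarrow\bigl(g_\gamma^{\leftarrow}(\Gamma_l),\ l\ge1\bigr)$$ weakly in $\mathbb R^\infty$ (with the product topology), where $\Gamma_l=E_1+\dots+E_l$ with $E_1,E_2,\dots$ i.i.d. standard exponential, so that $\Gamma_1<\Gamma_2<\cdots$ are the points of a unit-rate homogeneous Poisson process on $[0,\infty)$. -/

import Mathlib

open MeasureTheory ProbabilityTheory Filter Topology

/-- The `r`-th largest (with multiplicity, `1 ≤ r ≤ n`) of the `n` numbers `x 0, …, x (n - 1)`:
the entry at position `r` of these numbers listed in decreasing order. -/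
noncomputable def rthLargest (x : ℕ → ℝ) (r n : ℕ) : ℝ :=
  (((Multiset.range n).map x).sort (fun u v => v ≤ u)).getD (r - 1) 0

/-- `R(x) = -log (1 - F(x))`, with the value `+∞` where `F(x) = 1`. -/
noncomputable def cumHazard (F : ℝ → ℝ) (x : ℝ) : EReal :=
  -ENNReal.log (ENNReal.ofReal (1 - F x))

/-- `supp_γ = {x : 1 - γ x > 0}`. -/
def suppGamma (γ : ℝ) : Set ℝ := {x | 0 < 1 - γ * x}

/-- `g_γ(x) = (1 - γ x)^(-1/γ)` on `supp_γ`, read as `exp x` when `γ = 0`. -/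
noncomputable def gGamma (γ x : ℝ) : ℝ :=
  if γ = 0 then Real.exp x else (1 - γ * x) ^ (-1 / γ)

/-- The inverse `(0, ∞) → supp_γ` of `g_γ`. -/
noncomputable def gGammaInv (γ y : ℝ) : ℝ :=
  if γ = 0 then Real.log y else (1 - y ^ (-γ)) / γ

theorem gGammaInv_mem (γ : ℝ) {y : ℝ} (hy : 0 < y) : gGammaInv γ y ∈ suppGamma γ := by
  unfold gGammaInv suppGamma
  by_cases h : γ = 0
  · simp [h]
  · have h1 : 1 - γ * ((1 - y ^ (-γ)) / γ) = y ^ (-γ) := by field_simp; ring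
    simp only [h, if_false, Set.mem_ofPred_eq, h1]
    exact Real.rpow_pos_of_pos hy _

theorem gGamma_gGammaInv (γ : ℝ) {y : ℝ} (hy : 0 < y) : gGamma γ (gGammaInv γ y) = y := by
  unfold gGammaInv gGamma
  by_cases h : γ = 0
  · simp [h, Real.exp_log hy]
  · have h1 : 1 - γ * ((1 - y ^ (-γ)) / γ) = y ^ (-γ) := by field_simp; ring
    have h2 : -γ * (-1 / γ) = 1 := by field_simp
    simp only [h, if_false, h1]
    rw [← Real.rpow_mul hy.le, h2, Real.rpow_one]

theorem gGammaInv_gGamma (γ : ℝ) {x : ℝ} (hx : x ∈ suppGamma γ) :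
    gGammaInv γ (gGamma γ x) = x := by
  have hx' : 0 < 1 - γ * x := hx
  unfold gGammaInv gGamma
  by_cases h : γ = 0
  · simp [h]
  · have h2 : -1 / γ * -γ = 1 := by field_simp
    simp only [h, if_false]
    rw [← Real.rpow_mul hx'.le, h2, Real.rpow_one]
    field_simp
    ring

/-- The `l`-th point `Γ_l = E_1 + ⋯ + E_l` of the point process on `[0, ∞)` whose successive
spacings are `E 0, E 1, …`; when these are i.i.d. standard exponential, the `Γ_l`, `l ≥ 1`, are
the points of the unit-rate homogeneous Poisson process. -/
def arrival {Ω : Type*} (E : ℕ → Ω → ℝ) (l : ℕ) (ω : Ω) : ℝ :=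
  ∑ i ∈ Finset.range l, E i ω

/-! The `r`-th largest of `r + j` values is the `(j + 1)`-th smallest, so a lower extreme is at
stake. Let `Q` be `hazardQuantile μ`, nondecreasing on `(0, ∞)`. The sample has the law of `Q(u i)`
with `u i` i.i.d. standard exponential (`map_hazardQuantile`), and the hypothesis on `R`, inverted,
says that `(Q(w / r) + b r) / a r` tends to `gGammaInv γ w` for each `w > 0`
(`tendsto_hazardQuantile_rescaled`). It remains to see that `r` times the smallest `u i` behave like
`Γ_1, Γ_2, …`.

By the portmanteau theorem, lower bounds on open sets suffice, so inconvenient events can be thrown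
away. Keep only the event that the `d + 1` smallest of `r + d + 1` exponentials sit at indices below
`r`: they are then present in every sample of size `r + j`, and the statistics for `j ≤ d` are
exactly their images under `Q` (`rthLargest_eq_of_smallest`). Summing over the possible positions
gives `r.descFactorial (d + 1)` equal integrals (`descFactorial_mul_lintegral_le`). Substituting `v
k = (e 0 + ⋯ + e k) / r` turns each into an integral over i.i.d. exponential spacings `e`, with
Jacobian `r⁻¹ ^ (d + 1)` and a factor tending to `1` (`lintegral_partialSums_le`). Fatou's lemma
gives the bound for finitely many coordinates, and open sets of `ℝ^∞` are increasing unions of open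
cylinders. -/

/-! ### Order statistics through counting -/

theorem List.lt_getElem_iff_lt_countP {L : List ℝ} (hL : L.Pairwise (fun u v => v ≤ u)) (c : ℝ)
    {k : ℕ} (hk : k < L.length) : c < L[k] ↔ k < L.countP (fun v => c < v) := by
  induction L generalizing k with
  | nil => simp at hk
  | cons x L ih =>
    rw [List.pairwise_cons] at hL
    by_cases hx : c < x
    · cases k with
      | zero => simp [hx]
      | succ k =>
        have hk' : k < L.length := by simpa using hk
        simpa [hx] using ih hL.2 hk'
    · have h0 : (x :: L).countP (fun v => c < v) = 0 := by
        rw [List.countP_eq_zero]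
        intro v hv
        rcases List.mem_cons.1 hv with rfl | hv
        · simpa using hx
        · simpa using (hL.1 v hv).trans (not_lt.1 hx)
      have hle : (x :: L)[k] ≤ x := by
        cases k with
        | zero => simp
        | succ k => simpa using hL.1 _ (List.getElem_mem _)
      simp only [h0, Nat.not_lt_zero, iff_false, not_lt]
      exact hle.trans (not_lt.1 hx)

theorem lt_rthLargest_iff (x : ℕ → ℝ) (c : ℝ) {r n : ℕ} (h : r - 1 < n) :
    c < rthLargest x r n ↔ r - 1 < ((Finset.range n).filter (fun i => c < x i)).card := by
  unfold rthLargest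
  set L := ((Multiset.range n).map x).sort (fun u v => v ≤ u) with hLdef
  have hlen : L.length = n := by simp [hLdef]
  have hk : r - 1 < L.length := by rw [hlen]; exact h
  rw [List.getD_eq_getElem _ _ hk,
    List.lt_getElem_iff_lt_countP (Multiset.pairwise_sort _ _) c hk]
  have : L.countP (fun v => c < v) = ((Finset.range n).filter (fun i => c < x i)).card := by
    rw [← Multiset.coe_countP, hLdef, Multiset.sort_eq, Multiset.countP_map, Finset.card_def,
      Finset.filter_val, Finset.range_val]
  rw [this]

theorem measurable_rthLargest (r n : ℕ) : Measurable (fun x : ℕ → ℝ => rthLargest x r n) := by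
  by_cases h : r - 1 < n
  · refine measurable_of_Ioi fun c => ?_
    have : (fun x : ℕ → ℝ => rthLargest x r n) ⁻¹' Set.Ioi c =
        {x | r - 1 < ∑ i ∈ Finset.range n, if c < x i then 1 else 0} := by
      ext x
      simp [lt_rthLargest_iff x c h]
    rw [this]
    refine measurableSet_lt measurable_const (Finset.measurable_fun_sum _ fun i _ => ?_)
    exact Measurable.ite (measurableSet_lt measurable_const (measurable_pi_apply i))
      measurable_const measurable_const
  -- Position `r - 1` is out of range here, so the default value `0` is returned.
  · have : (fun x : ℕ → ℝ => rthLargest x r n) = fun _ => 0 := by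
      funext x
      exact List.getD_eq_default _ _ (by simpa using h)
    rw [this]
    exact measurable_const

/-- If the `d + 1` smallest of `x 0, …, x (r + d)` are attained in order at the indices `s 0, …, s d`,
all below `r`, then they are the successive values of the `r`-th largest of the first `r + j`. -/
theorem rthLargest_eq_of_smallest {x : ℕ → ℝ} {r d : ℕ} {s : Fin (d + 1) → ℕ}
    (hs : Function.Injective s) (hsr : ∀ k, s k < r) (hmono : Monotone (fun k => x (s k)))
    (hlast : ∀ m < r + (d + 1), m ∉ Set.range s → x (s (Fin.last d)) ≤ x m) (j : Fin (d + 1)) :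
    rthLargest x r (r + j) = x (s j) := by
  have hr : 0 < r := (Nat.zero_le _).trans_lt (hsr 0)
  have hle : ∀ m < r + (j : ℕ), (∀ k < j, s k ≠ m) → x (s j) ≤ x m := by
    intro m hm hmk
    by_cases hms : m ∈ Set.range s
    · obtain ⟨k, rfl⟩ := hms
      exact hmono (not_lt.1 fun hk => hmk k hk rfl)
    · exact (hmono (Fin.le_last j)).trans (hlast m (by omega) hms)
  refine eq_of_forall_lt_iff fun c => ?_
  rw [lt_rthLargest_iff x c (by omega)]
  constructor
  · intro h
    by_contra hc
    rw [not_lt] at hc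
    -- If `x (s j) ≤ c`, the `j + 1` indices `s 0, …, s j` are not counted, which leaves at most `r
    -- - 1`.
    have hsub : (Finset.range (r + j)).filter (fun i => c < x i) ⊆
        Finset.range (r + j) \ (Finset.Iic j).image s := by
      intro i hi
      simp only [Finset.mem_filter, Finset.mem_sdiff, Finset.mem_image, Finset.mem_Iic] at hi ⊢
      refine ⟨hi.1, ?_⟩
      rintro ⟨k, hk, rfl⟩
      exact absurd hi.2 (not_lt.2 ((hmono hk).trans hc))
    have hsub2 : (Finset.Iic j).image s ⊆ Finset.range (r + j) := by
      intro i hi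
      obtain ⟨k, -, rfl⟩ := Finset.mem_image.1 hi
      exact Finset.mem_range.2 ((hsr k).trans_le (Nat.le_add_right _ _))
    have := Finset.card_le_card hsub
    rw [Finset.card_sdiff_of_subset hsub2, Finset.card_image_of_injective _ hs, Fin.card_Iic,
      Finset.card_range] at this
    omega
  · intro hc
    -- If `c < x (s j)`, only the `j` indices before `s j` can fail, so at least `r` are counted.
    have hsub : Finset.range (r + j) \ (Finset.Iio j).image s ⊆
        (Finset.range (r + j)).filter (fun i => c < x i) := by
      intro i hi
      simp only [Finset.mem_filter, Finset.mem_sdiff, Finset.mem_image, Finset.mem_Iio,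
        not_exists, not_and] at hi ⊢
      exact ⟨hi.1, hc.trans_le (hle i (Finset.mem_range.1 hi.1) hi.2)⟩
    have hsub2 : (Finset.Iio j).image s ⊆ Finset.range (r + j) := by
      intro i hi
      obtain ⟨k, -, rfl⟩ := Finset.mem_image.1 hi
      exact Finset.mem_range.2 ((hsr k).trans_le (Nat.le_add_right _ _))
    have := Finset.card_le_card hsub
    rw [Finset.card_sdiff_of_subset hsub2, Finset.card_image_of_injective _ hs, Fin.card_Iio,
      Finset.card_range] at this
    omega

/-! ### The functions `g_γ` and the cumulative hazard -/

theorem gGamma_strictMonoOn (γ : ℝ) : StrictMonoOn (gGamma γ) (suppGamma γ) := by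
  intro x hx y hy hxy
  have hx' : 0 < 1 - γ * x := hx
  have hy' : 0 < 1 - γ * y := hy
  unfold gGamma
  rcases lt_trichotomy γ 0 with h | h | h
  · simp only [h.ne, if_false]
    exact Real.rpow_lt_rpow hx'.le (by nlinarith) (div_pos_of_neg_of_neg (by norm_num) h)
  · simpa [h] using hxy
  · simp only [h.ne', if_false]
    exact Real.rpow_lt_rpow_of_neg hy' (by nlinarith) (div_neg_of_neg_of_pos (by norm_num) h)

theorem measurable_gGammaInv (γ : ℝ) : Measurable (gGammaInv γ) := by
  unfold gGammaInv
  by_cases h : γ = 0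
  · simpa [h] using Real.measurable_log
  · simp only [h, if_false]
    fun_prop

theorem isOpen_suppGamma (γ : ℝ) : IsOpen (suppGamma γ) :=
  isOpen_lt continuous_const (by fun_prop)

theorem cumHazard_of_lt_one {F : ℝ → ℝ} {y : ℝ} (h : F y < 1) :
    cumHazard F y = ((-Real.log (1 - F y) : ℝ) : EReal) := by
  unfold cumHazard
  rw [ENNReal.log_ofReal_of_pos (sub_pos.2 h), EReal.coe_neg]

theorem cumHazard_of_one_le {F : ℝ → ℝ} {y : ℝ} (h : 1 ≤ F y) : cumHazard F y = ⊤ := by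
  unfold cumHazard
  rw [ENNReal.ofReal_of_nonpos (by linarith), ENNReal.log_zero, EReal.neg_bot]

/-- Exponentiation removes the logarithm in `R`. Where `F y ≥ 1` the product is `⊤`, which the
hypothesis excludes. -/
theorem lt_one_sub_exp_of_mul_cumHazard_lt {F : ℝ → ℝ} {y w : ℝ} {r : ℕ} (hr : 0 < r)
    (h : (r : EReal) * cumHazard F y < (w : EReal)) : F y < 1 - Real.exp (-(w / r)) := by
  have hr' : (0 : ℝ) < r := Nat.cast_pos.2 hr
  rcases lt_or_ge (F y) 1 with hF | hF
  · rw [cumHazard_of_lt_one hF, show (r : EReal) = ((r : ℝ) : EReal) from rfl, ← EReal.coe_mul,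
      EReal.coe_lt_coe_iff, ← lt_div_iff₀' hr'] at h
    have := (Real.lt_log_iff_exp_lt (sub_pos.2 hF)).1 (show -(w / r) < _ by linarith)
    linarith
  · rw [cumHazard_of_one_le hF, EReal.mul_top_of_pos (by exact_mod_cast hr)] at h
    exact absurd h not_top_lt

theorem one_sub_exp_le_of_lt_mul_cumHazard {F : ℝ → ℝ} {y w : ℝ} {r : ℕ} (hr : 0 < r)
    (h : (w : EReal) < (r : EReal) * cumHazard F y) : 1 - Real.exp (-(w / r)) ≤ F y := by
  have hr' : (0 : ℝ) < r := Nat.cast_pos.2 hr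
  rcases lt_or_ge (F y) 1 with hF | hF
  · rw [cumHazard_of_lt_one hF, show (r : EReal) = ((r : ℝ) : EReal) from rfl, ← EReal.coe_mul,
      EReal.coe_lt_coe_iff, ← div_lt_iff₀' hr'] at h
    have := (Real.log_lt_iff_lt_exp (sub_pos.2 hF)).1 (show _ < -(w / r) by linarith)
    linarith
  · have := Real.exp_pos (-(w / r))
    linarith

/-! ### Quantile transform of an exponential variable -/

/-- The generalized inverse of the cumulative hazard function of `μ`, set to `0` on `(-∞, 0]`. -/
noncomputable def hazardQuantile (μ : Measure ℝ) (u : ℝ) : ℝ :=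
  if 0 < u then sInf {x | 1 - Real.exp (-u) ≤ cdf μ x} else 0

/-- Galois connection between quantile and distribution function. Since `u > 0` puts the level in
`(0, 1)`, the infimum is over a nonempty set bounded below, and right-continuity of the cdf makes it
attained. -/
theorem hazardQuantile_le_iff (μ : Measure ℝ) {u : ℝ} (hu : 0 < u) (y : ℝ) :
    hazardQuantile μ u ≤ y ↔ 1 - Real.exp (-u) ≤ cdf μ y := by
  have h1 : 1 - Real.exp (-u) < 1 := by linarith [Real.exp_pos (-u)]
  have h0 : 0 < 1 - Real.exp (-u) := by
    have : Real.exp (-u) < 1 := by simpa using hu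
    linarith
  set p := 1 - Real.exp (-u) with hp
  have hne : {x | p ≤ cdf μ x}.Nonempty := by
    obtain ⟨x, hx⟩ := ((tendsto_cdf_atTop μ).eventually (lt_mem_nhds h1)).exists
    exact ⟨x, hx.le⟩
  have hbdd : BddBelow {x | p ≤ cdf μ x} := by
    obtain ⟨x, hx⟩ := ((tendsto_cdf_atBot μ).eventually (gt_mem_nhds h0)).exists
    refine ⟨x, fun z hz => ?_⟩
    by_contra hzx
    exact absurd ((monotone_cdf μ) (not_le.1 hzx).le) (not_le.2 (hx.trans_le hz))
  simp only [hazardQuantile, hu, if_true, ← hp]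
  refine ⟨fun h => ?_, fun h => csInf_le hbdd h⟩
  have hcont : Tendsto (cdf μ) (𝓝[>] y) (𝓝 (cdf μ y)) :=
    ((cdf μ).right_continuous y).mono_left (nhdsWithin_mono _ Set.Ioi_subset_Ici_self)
  refine ge_of_tendsto hcont ?_
  filter_upwards [self_mem_nhdsWithin] with z hz
  obtain ⟨s, hs, hsz⟩ := exists_lt_of_csInf_lt hne (h.trans_lt hz)
  exact le_trans hs (monotone_cdf μ hsz.le)

theorem hazardQuantile_monotoneOn (μ : Measure ℝ) :
    MonotoneOn (hazardQuantile μ) (Set.Ioi 0) := by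
  intro u hu v hv huv
  rw [hazardQuantile_le_iff μ hu]
  have := (hazardQuantile_le_iff μ hv _).1 le_rfl
  have h2 : Real.exp (-v) ≤ Real.exp (-u) := Real.exp_le_exp.2 (by linarith)
  linarith

theorem measurable_hazardQuantile (μ : Measure ℝ) : Measurable (hazardQuantile μ) := by
  refine measurable_of_Iic fun y => ?_
  have : hazardQuantile μ ⁻¹' Set.Iic y =
      {u | 0 < u ∧ 1 - Real.exp (-u) ≤ cdf μ y} ∪ {u | ¬ 0 < u ∧ 0 ≤ y} := by
    ext u
    by_cases hu : 0 < u
    · simp [hu, hazardQuantile_le_iff μ hu]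
    · simpa [hu, hazardQuantile] using fun _ => not_lt.1 hu
  rw [this]
  have hexp : Measurable fun u : ℝ => 1 - Real.exp (-u) := by fun_prop
  exact (measurableSet_Ioi.inter (measurableSet_le hexp measurable_const)).union
    (measurableSet_Ioi.compl.inter (MeasurableSet.const (0 ≤ y)))

instance isProbabilityMeasure_expMeasure_one : IsProbabilityMeasure (expMeasure 1) :=
  isProbabilityMeasure_expMeasure one_pos

theorem expMeasure_one_Iic {t : ℝ} (ht : 0 ≤ t) :
    expMeasure 1 (Set.Iic t) = ENNReal.ofReal (1 - Real.exp (-t)) := by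
  rw [← ofReal_cdf, cdf_expMeasure_eq one_pos, if_pos ht, one_mul]

theorem expMeasure_one_Ioi {t : ℝ} (ht : 0 ≤ t) :
    expMeasure 1 (Set.Ioi t) = ENNReal.ofReal (Real.exp (-t)) := by
  have h1 : Real.exp (-t) ≤ 1 := Real.exp_le_one_iff.2 (by linarith)
  rw [← Set.compl_Iic, prob_compl_eq_one_sub measurableSet_Iic, expMeasure_one_Iic ht,
    ← ENNReal.ofReal_one, ← ENNReal.ofReal_sub _ (by linarith)]
  congr 1
  ring

theorem expMeasure_one_ae_pos : ∀ᵐ u ∂(expMeasure 1), 0 < u := by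
  have : expMeasure 1 (Set.Iic 0) = 0 := by simp [expMeasure_one_Iic le_rfl]
  rw [ae_iff]
  convert this using 2
  ext; simp

theorem map_hazardQuantile (μ : Measure ℝ) [IsProbabilityMeasure μ] :
    (expMeasure 1).map (hazardQuantile μ) = μ := by
  have hQ := measurable_hazardQuantile μ
  have := Measure.isProbabilityMeasure_map (μ := expMeasure 1) hQ.aemeasurable
  refine Measure.ext_of_Iic _ _ fun y => ?_
  rw [Measure.map_apply hQ measurableSet_Iic, ← ofReal_cdf μ]
  rcases (cdf_le_one μ y).lt_or_eq with hy | hy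
  · have hlog : Real.exp (-(-Real.log (1 - cdf μ y))) = 1 - cdf μ y := by
      rw [neg_neg, Real.exp_log (sub_pos.2 hy)]
    have ht : 0 ≤ -Real.log (1 - cdf μ y) := by
      have := Real.log_nonpos (sub_pos.2 hy).le (by linarith [cdf_nonneg μ y])
      linarith
    have hae : (hazardQuantile μ ⁻¹' Set.Iic y : Set ℝ) =ᵐ[expMeasure 1]
        Set.Iic (-Real.log (1 - cdf μ y)) := by
      filter_upwards [expMeasure_one_ae_pos] with u hu
      refine propext ?_
      change hazardQuantile μ u ≤ y ↔ u ≤ _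
      rw [hazardQuantile_le_iff μ hu, le_neg, Real.log_le_iff_le_exp (sub_pos.2 hy)]
      constructor <;> intro h <;> linarith
    rw [measure_congr hae, expMeasure_one_Iic ht, hlog, sub_sub_cancel]
  -- There is no finite threshold here: every `u > 0` is sent below `y`.
  · rw [hy, ENNReal.ofReal_one]
    refine (prob_compl_eq_zero_iff (hQ measurableSet_Iic)).1 ?_
    refine measure_mono_null ?_ (ae_iff.1 expMeasure_one_ae_pos)
    intro u hu hu'
    refine hu ?_
    change hazardQuantile μ u ≤ y
    rw [hazardQuantile_le_iff μ hu', hy]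
    linarith [Real.exp_pos (-u)]

/-- Comparing `Q(w / r)` with `a r * x - b r` amounts to comparing `w` with `r R(a r * x - b r)`,
hence in the limit with `g_γ(x)`. Strict monotonicity of `g_γ` lets `x` approach `gGammaInv γ w`
from either side. -/
theorem tendsto_hazardQuantile_rescaled (μ : Measure ℝ) {γ : ℝ} {a b : ℕ → ℝ}
    (ha : ∀ r, 1 ≤ r → 0 < a r)
    (hR : ∀ x ∈ suppGamma γ,
      Tendsto (fun r : ℕ => (r : EReal) * cumHazard (cdf μ) (a r * x - b r)) atTop
        (𝓝 ((gGamma γ x : ℝ) : EReal))) {w : ℝ} (hw : 0 < w) :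
    Tendsto (fun r : ℕ => (hazardQuantile μ (w / r) + b r) / a r) atTop (𝓝 (gGammaInv γ w)) := by
  have hmem := gGammaInv_mem γ hw
  have hnhds := (isOpen_suppGamma γ).mem_nhds hmem
  refine tendsto_order.2 ⟨fun c hc => ?_, fun c hc => ?_⟩
  · obtain ⟨x, ⟨hxs, hcx⟩, hx⟩ := ((eventually_nhdsWithin_of_eventually_nhds
      (s := Set.Iio (gGammaInv γ w)) (hnhds : ∀ᶠ x in 𝓝 _, x ∈ suppGamma γ)).and
      (eventually_nhdsWithin_of_eventually_nhds (lt_mem_nhds hc)) |>.and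
      self_mem_nhdsWithin).exists
    have hg : gGamma γ x < w := by
      simpa [gGamma_gGammaInv γ hw] using gGamma_strictMonoOn γ hxs hmem hx
    filter_upwards [(hR x hxs).eventually (gt_mem_nhds (EReal.coe_lt_coe_iff.2 hg)),
      eventually_ge_atTop 1] with r hr hr1
    have har := ha r hr1
    have hlt := lt_one_sub_exp_of_mul_cumHazard_lt hr1 hr
    rw [← not_le, ← hazardQuantile_le_iff μ (div_pos hw (Nat.cast_pos.2 hr1)), not_le] at hlt
    refine hcx.trans ?_
    rw [lt_div_iff₀ har]
    linarith
  · obtain ⟨x, ⟨hxs, hcx⟩, hx⟩ := ((eventually_nhdsWithin_of_eventually_nhds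
      (s := Set.Ioi (gGammaInv γ w)) (hnhds : ∀ᶠ x in 𝓝 _, x ∈ suppGamma γ)).and
      (eventually_nhdsWithin_of_eventually_nhds (gt_mem_nhds hc)) |>.and
      self_mem_nhdsWithin).exists
    have hg : w < gGamma γ x := by
      simpa [gGamma_gGammaInv γ hw] using gGamma_strictMonoOn γ hmem hxs hx
    filter_upwards [(hR x hxs).eventually (lt_mem_nhds (EReal.coe_lt_coe_iff.2 hg)),
      eventually_ge_atTop 1] with r hr hr1
    have har := ha r hr1
    have hle := one_sub_exp_le_of_lt_mul_cumHazard hr1 hr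
    rw [← hazardQuantile_le_iff μ (div_pos hw (Nat.cast_pos.2 hr1))] at hle
    refine lt_of_le_of_lt ?_ hcx
    rw [div_le_iff₀ har]
    linarith

/-! ### Finite products of measures with density -/

theorem lintegral_fin_prod_eq_prod {n : ℕ} {μ : Measure ℝ} [SigmaFinite μ]
    {f : Fin n → ℝ → ENNReal} (hf : ∀ i, Measurable (f i)) :
    ∫⁻ x, ∏ i, f i (x i) ∂(Measure.pi fun _ : Fin n => μ) = ∏ i, ∫⁻ t, f i t ∂μ := by
  induction n with
  | zero => simp
  | succ n ih =>
    have hmp := (measurePreserving_piFinSuccAbove (fun _ : Fin (n + 1) => μ) 0).symm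
    rw [← hmp.lintegral_comp (by fun_prop)]
    simp only [MeasurableEquiv.piFinSuccAbove_symm_apply, Fin.prod_univ_succ,
      Fin.insertNthEquiv_apply, Fin.insertNth_zero, Fin.cons_zero, Fin.cons_succ, cast_eq]
    rw [lintegral_prod_mul (f := f 0) (g := fun y : Fin n → ℝ => ∏ i, f i.succ (y i))
      (hf 0).aemeasurable (Finset.measurable_fun_prod _ fun i _ =>
        (hf i.succ).comp (measurable_pi_apply i)).aemeasurable, ih fun i => hf i.succ]

theorem pi_withDensity_eq {n : ℕ} {μ : Measure ℝ} [SigmaFinite μ] {f : ℝ → ENNReal}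
    (hf : Measurable f) [SigmaFinite (μ.withDensity f)] :
    (Measure.pi fun _ : Fin n => μ.withDensity f) =
      (Measure.pi fun _ : Fin n => μ).withDensity (fun x => ∏ i, f (x i)) := by
  refine Measure.pi_eq fun s hs => ?_
  rw [withDensity_apply _ (MeasurableSet.univ_pi hs),
    ← lintegral_indicator (MeasurableSet.univ_pi hs)]
  have : ∀ x : Fin n → ℝ, (Set.univ.pi s).indicator (fun x => ∏ i, f (x i)) x =
      ∏ i, (s i).indicator f (x i) := by
    intro x
    by_cases hx : x ∈ Set.univ.pi s
    · rw [Set.indicator_of_mem hx]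
      exact Finset.prod_congr rfl fun i _ => (Set.indicator_of_mem (hx i trivial) f).symm
    · rw [Set.indicator_of_notMem hx]
      obtain ⟨i, hi⟩ : ∃ i, x i ∉ s i := by simpa [Set.mem_pi] using hx
      exact (Finset.prod_eq_zero (Finset.mem_univ i) (Set.indicator_of_notMem hi f)).symm
  simp_rw [this]
  rw [lintegral_fin_prod_eq_prod fun i => hf.indicator (hs i)]
  refine Finset.prod_congr rfl fun i _ => ?_
  rw [lintegral_indicator (hs i), withDensity_apply _ (hs i)]

/-! ### Scaled partial sums as a change of variables -/

/-- The partial sums `e 0 + ⋯ + e k`. -/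
def partialSums {n : ℕ} (e : Fin n → ℝ) (k : Fin n) : ℝ := ∑ i ∈ Finset.Iic k, e i

theorem measurable_partialSums {n : ℕ} : Measurable (partialSums (n := n)) :=
  measurable_pi_lambda _ fun _ => Finset.measurable_fun_sum _ fun i _ => measurable_pi_apply i

theorem partialSums_pos {n : ℕ} {e : Fin n → ℝ} (he : ∀ i, 0 < e i) (k : Fin n) :
    0 < partialSums e k :=
  Finset.sum_pos (fun i _ => he i) ⟨k, by simp⟩

theorem partialSums_strictMono {n : ℕ} {e : Fin n → ℝ} (he : ∀ i, 0 < e i) :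
    StrictMono (partialSums e) := by
  intro k l hkl
  refine Finset.sum_lt_sum_of_subset (i := l) (Finset.Iic_subset_Iic.2 hkl.le) (by simp)
    (by simpa using hkl) (he l) fun j _ _ => (he j).le

theorem partialSums_last {d : ℕ} (e : Fin (d + 1) → ℝ) :
    partialSums e (Fin.last d) = ∑ i, e i := by
  unfold partialSums
  congr 1
  ext i
  simp [Fin.le_last]

theorem lintegral_eq_lintegral_partialSums {n : ℕ} {r : ℝ} (hr : 0 < r)
    {f : (Fin n → ℝ) → ENNReal} (hf : Measurable f) :
    ∫⁻ v, f v = ENNReal.ofReal (r⁻¹ ^ n) * ∫⁻ e, f (fun k => partialSums e k / r) := by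
  -- The map `e ↦ partialSums e / r` is lower triangular with diagonal entries `r⁻¹`.
  let M : Matrix (Fin n) (Fin n) ℝ := Matrix.of fun k i => if i ≤ k then r⁻¹ else 0
  have hM : M.det = r⁻¹ ^ n := by
    rw [Matrix.det_of_isLowerTriangular M]
    · simp [M]
    · intro k i hki
      have : ¬ i ≤ k := not_le.2 hki
      simp [M, this]
  have hpos : 0 < r⁻¹ ^ n := pow_pos (inv_pos.2 hr) n
  have happ : ∀ e : Fin n → ℝ, Matrix.toLin' M e = fun k => partialSums e k / r := by
    intro e
    funext k
    simp only [Matrix.toLin'_apply, Matrix.mulVec, dotProduct, M, Matrix.of_apply, ite_mul,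
      zero_mul, ← Finset.sum_filter, partialSums, Finset.sum_div]
    refine Finset.sum_congr (by ext; simp) fun i _ => ?_
    ring
  have hmap := Real.map_matrix_volume_pi_eq_smul_volume_pi (M := M) (by rw [hM]; exact hpos.ne')
  have hmeas : Measurable (Matrix.toLin' M) := by
    have : ⇑(Matrix.toLin' M) = fun e k => partialSums e k / r := funext happ
    rw [this]
    exact measurable_pi_lambda _ fun k =>
      ((measurable_pi_apply k).comp measurable_partialSums).div_const r
  simp_rw [← happ]
  rw [← lintegral_map hf hmeas, hmap, lintegral_smul_measure, hM, smul_eq_mul, ← mul_assoc,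
    ← ENNReal.ofReal_mul hpos.le, abs_of_pos (inv_pos.2 hpos), mul_inv_cancel₀ hpos.ne',
    ENNReal.ofReal_one, one_mul]

/-! ### Location of the smallest values of an i.i.d. sample -/

/-- The blocks indexed by `s` and `T` are independent. Given the values `v` on the first, each
coordinate in `T` independently exceeds the last entry of `v`. -/
theorem infinitePi_setOf_lt_eq {ν : Measure ℝ} [IsProbabilityMeasure ν] {d : ℕ} {s : Fin (d + 1) → ℕ}
    (hs : Function.Injective s) {T : Finset ℕ} (hT : ∀ k, s k ∉ T) {B : Set (Fin (d + 1) → ℝ)}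
    (hB : MeasurableSet B) :
    Measure.infinitePi (fun _ : ℕ => ν)
        {u | (fun k => u (s k)) ∈ B ∧ ∀ m ∈ T, u (s (Fin.last d)) < u m} =
      ∫⁻ v in B, ν (Set.Ioi (v (Fin.last d))) ^ T.card ∂(Measure.pi fun _ => ν) := by
  have hind : iIndepFun (fun (i : ℕ) (u : ℕ → ℝ) => u i) (Measure.infinitePi fun _ => ν) :=
    iIndepFun_infinitePi (X := fun _ x => x) (fun _ => measurable_id)
  have hlaw : ∀ i, HasLaw (fun u : ℕ → ℝ => u i) ν (Measure.infinitePi fun _ => ν) := fun i =>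
    ⟨(measurable_pi_apply i).aemeasurable, Measure.infinitePi_map_eval _ i⟩
  have hdisj : Disjoint (Finset.univ.image s) T := by
    rw [Finset.disjoint_left]
    intro i hi
    obtain ⟨k, -, rfl⟩ := Finset.mem_image.1 hi
    exact hT k
  have h1 : HasLaw (fun (u : ℕ → ℝ) k => u (s k)) (Measure.pi fun _ => ν)
      (Measure.infinitePi fun _ => ν) := iIndepFun.hasLaw_pi (fun k => hlaw (s k)) (hind.precomp hs)
  have h2 : HasLaw (fun (u : ℕ → ℝ) (m : T) => u m) (Measure.pi fun _ => ν)
      (Measure.infinitePi fun _ => ν) :=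
    iIndepFun.hasLaw_pi (fun m : T => hlaw m) (hind.precomp Subtype.val_injective)
  have hm1 : Measurable fun (u : ℕ → ℝ) k => u (s k) :=
    measurable_pi_lambda _ fun k => measurable_pi_apply (s k)
  have hm2 : Measurable fun (u : ℕ → ℝ) (m : T) => u m :=
    measurable_pi_lambda _ fun m => measurable_pi_apply (m : ℕ)
  let φ : ({m // m ∈ Finset.univ.image s} → ℝ) → Fin (d + 1) → ℝ :=
    fun w k => w ⟨s k, Finset.mem_image_of_mem s (Finset.mem_univ k)⟩
  have hφ : Measurable φ := measurable_pi_lambda _ fun k => measurable_pi_apply _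
  have h12 : IndepFun (fun (u : ℕ → ℝ) k => u (s k)) (fun (u : ℕ → ℝ) (m : T) => u m)
      (Measure.infinitePi fun _ => ν) :=
    (hind.indepFun_finset _ T hdisj fun i => measurable_pi_apply i).comp hφ measurable_id
  have h3 := (indepFun_iff_map_prod_eq_prod_map_map hm1.aemeasurable hm2.aemeasurable).1 h12
  rw [h1.map_eq, h2.map_eq] at h3
  set D : Set ((Fin (d + 1) → ℝ) × (T → ℝ)) := {p | p.1 ∈ B ∧ ∀ m, p.1 (Fin.last d) < p.2 m}
    with hD
  have hDm : MeasurableSet D := by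
    refine (measurable_fst hB).inter ?_
    have : {p : (Fin (d + 1) → ℝ) × (T → ℝ) | ∀ m, p.1 (Fin.last d) < p.2 m} =
      ⋂ m, {p | p.1 (Fin.last d) < p.2 m} := by ext; simp
    change MeasurableSet {p : (Fin (d + 1) → ℝ) × (T → ℝ) | ∀ m, p.1 (Fin.last d) < p.2 m}
    rw [this]
    exact MeasurableSet.iInter fun m => measurableSet_lt (by fun_prop) (by fun_prop)
  have hset : {u : ℕ → ℝ | (fun k => u (s k)) ∈ B ∧ ∀ m ∈ T, u (s (Fin.last d)) < u m} =
      (fun u => ((fun k => u (s k)), fun m : T => u m)) ⁻¹' D := by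
    ext u
    simp [hD]
  rw [hset, ← Measure.map_apply (hm1.prodMk hm2) hDm, h3, Measure.prod_apply hDm,
    ← lintegral_indicator hB]
  refine lintegral_congr fun v => ?_
  by_cases hv : v ∈ B
  · have : Prod.mk v ⁻¹' D = Set.univ.pi fun _ => Set.Ioi (v (Fin.last d)) := by
      ext w
      simp [hD, hv]
    rw [this, Measure.pi_pi, Set.indicator_of_mem hv]
    simp
  · have : Prod.mk v ⁻¹' D = ∅ := by
      ext w
      simp [hD, hv]
    rw [this, Set.indicator_of_notMem hv, measure_empty]

/-- The `d + 1` smallest of `u 0, …, u (N - 1)` are attained at the indices `s 0, …, s d`, in strictly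
increasing order, and are strictly smaller than the remaining values. -/
def IsSmallestAt {d : ℕ} (N : ℕ) (u : ℕ → ℝ) (s : Fin (d + 1) → ℕ) : Prop :=
  StrictMono (fun k => u (s k)) ∧ ∀ m < N, m ∉ Set.range s → u (s (Fin.last d)) < u m

theorem IsSmallestAt.unique {d N : ℕ} {u : ℕ → ℝ} {s t : Fin (d + 1) → ℕ}
    (hs : IsSmallestAt N u s) (ht : IsSmallestAt N u t) (hsN : ∀ k, s k < N) (htN : ∀ k, t k < N) :
    s = t := by
  -- At a first disagreement the value at `s k` would be strictly below that at `t k`, and by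
  -- symmetry also strictly above it.
  have key : ∀ {s t : Fin (d + 1) → ℕ}, IsSmallestAt N u s → IsSmallestAt N u t →
      (∀ k, t k < N) → ∀ k, (∀ i < k, s i = t i) → s k = t k ∨ u (s k) < u (t k) := by
    intro s t hs ht htN k hk
    by_cases h : t k ∈ Set.range s
    · obtain ⟨l, hl⟩ := h
      rcases lt_trichotomy l k with hlk | rfl | hlk
      · have := ht.1 hlk
        simp only [← hk l hlk, hl, lt_irrefl] at this
      · exact Or.inl hl
      · exact Or.inr (hl ▸ hs.1 hlk)
    · exact Or.inr ((hs.1.monotone (Fin.le_last k)).trans_lt (hs.2 _ (htN k) h))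
  funext k
  induction k using WellFoundedLT.induction with
  | ind k ih =>
    rcases key hs ht htN k ih with h | h
    · exact h
    · rcases key ht hs hsN k fun i hi => (ih i hi).symm with h' | h'
      · exact h'.symm
      · exact absurd h h'.not_gt

theorem measurableSet_strictMono (n : ℕ) : MeasurableSet {v : Fin n → ℝ | StrictMono v} := by
  have : {v : Fin n → ℝ | StrictMono v} = ⋂ i, ⋂ j, ⋂ _ : i < j, {v | v i < v j} := by
    ext v
    simp [StrictMono]
  rw [this]
  exact MeasurableSet.iInter fun i => MeasurableSet.iInter fun j => MeasurableSet.iInter fun _ =>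
    measurableSet_lt (measurable_pi_apply i) (measurable_pi_apply j)

/-- There is one event for each embedding of the `d + 1` positions into the first `r` indices. The
events are disjoint by `IsSmallestAt.unique` and equiprobable. A sample of size `r + (d + 1)` leaves
exactly `r` other coordinates, whence the exponent `r`. -/
theorem descFactorial_mul_lintegral_le {ν : Measure ℝ} [IsProbabilityMeasure ν] {d : ℕ} (r : ℕ)
    {H : Set (Fin (d + 1) → ℝ)} (hH : MeasurableSet H) :
    (r.descFactorial (d + 1) : ENNReal) * ∫⁻ v in {v | StrictMono v} ∩ H,
        ν (Set.Ioi (v (Fin.last d))) ^ r ∂(Measure.pi fun _ => ν) ≤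
      Measure.infinitePi (fun _ : ℕ => ν) {u | ∃ s : Fin (d + 1) → ℕ, Function.Injective s ∧
        (∀ k, s k < r) ∧ IsSmallestAt (r + (d + 1)) u s ∧ (fun k => u (s k)) ∈ H} := by
  let A : (Fin (d + 1) ↪ Fin r) → Set (ℕ → ℝ) := fun s =>
    {u | (fun k => u (s k)) ∈ {v | StrictMono v} ∩ H ∧
      ∀ m ∈ Finset.range (r + (d + 1)) \ Finset.univ.image (fun k => (s k : ℕ)),
        u (s (Fin.last d)) < u m}
  have hAs : ∀ s u, u ∈ A s ↔ IsSmallestAt (r + (d + 1)) u (fun k => (s k : ℕ)) ∧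
      (fun k => u (s k)) ∈ H := by
    intro s u
    simp only [A, IsSmallestAt, Set.mem_ofPred_eq, Set.mem_inter_iff, Finset.mem_sdiff,
      Finset.mem_range, Finset.mem_image, Finset.mem_univ, true_and, Set.mem_range]
    constructor
    · rintro ⟨⟨h1, h2⟩, h3⟩
      exact ⟨⟨h1, fun m hm hms => h3 m ⟨hm, hms⟩⟩, h2⟩
    · rintro ⟨⟨h1, h3⟩, h2⟩
      exact ⟨⟨h1, h2⟩, fun m hm => h3 m hm.1 hm.2⟩
  have hinj : ∀ s : Fin (d + 1) ↪ Fin r, Function.Injective fun k => (s k : ℕ) := fun s =>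
    Fin.val_injective.comp s.injective
  have hB : MeasurableSet ({v : Fin (d + 1) → ℝ | StrictMono v} ∩ H) :=
    (measurableSet_strictMono _).inter hH
  have hAm : ∀ s, MeasurableSet (A s) := by
    intro s
    have hm1 : Measurable fun (u : ℕ → ℝ) k => u (s k : ℕ) :=
      measurable_pi_lambda _ fun k => measurable_pi_apply _
    have hm2 : MeasurableSet {u : ℕ → ℝ |
        ∀ m ∈ Finset.range (r + (d + 1)) \ Finset.univ.image (fun k => (s k : ℕ)),
          u (s (Fin.last d)) < u m} := by
      simp only [Set.ofPred_forall]
      exact MeasurableSet.iInter fun m => MeasurableSet.iInter fun _ =>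
        measurableSet_lt (measurable_pi_apply _) (measurable_pi_apply _)
    exact (hm1 hB).inter hm2
  have hAμ : ∀ s, Measure.infinitePi (fun _ : ℕ => ν) (A s) =
      ∫⁻ v in {v | StrictMono v} ∩ H, ν (Set.Ioi (v (Fin.last d))) ^ r
        ∂(Measure.pi fun _ => ν) := by
    intro s
    have hcard : (Finset.range (r + (d + 1)) \
        Finset.univ.image (fun k => (s k : ℕ))).card = r := by
      rw [Finset.card_sdiff_of_subset, Finset.card_image_of_injective _ (hinj s)]
      · simp
      · intro i hi
        obtain ⟨k, -, rfl⟩ := Finset.mem_image.1 hi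
        have := (s k).2
        simp only [Finset.mem_range]
        omega
    have := infinitePi_setOf_lt_eq (ν := ν) (hinj s)
      (T := Finset.range (r + (d + 1)) \ Finset.univ.image (fun k => (s k : ℕ))) (by simp) hB
    rwa [hcard] at this
  have hdisj : Pairwise (Function.onFun Disjoint A) := by
    intro s t hst
    refine Set.disjoint_left.2 fun u hs ht => hst ?_
    have := ((hAs s u).1 hs).1.unique ((hAs t u).1 ht).1
      (fun k => (s k).2.trans_le (Nat.le_add_right _ _))
      (fun k => (t k).2.trans_le (Nat.le_add_right _ _))
    ext k
    exact congrFun this k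
  calc (r.descFactorial (d + 1) : ENNReal) * _
      = ∑ s, Measure.infinitePi (fun _ : ℕ => ν) (A s) := by
        simp_rw [hAμ]
        rw [Finset.sum_const, Finset.card_univ, Fintype.card_embedding_eq]
        simp
    _ = Measure.infinitePi (fun _ : ℕ => ν) (⋃ s, A s) := by
        rw [measure_iUnion hdisj hAm, tsum_fintype]
    _ ≤ _ := by
        refine measure_mono (Set.iUnion_subset fun s u hu => ?_)
        exact ⟨fun k => s k, hinj s, fun k => (s k).2, (hAs s u).1 hu⟩

/-! ### Exponential spacings -/

theorem prod_exponentialPDF_one {n : ℕ} {v : Fin n → ℝ} (hv : ∀ k, 0 < v k) :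
    ∏ k, exponentialPDF 1 (v k) = ENNReal.ofReal (Real.exp (-∑ k, v k)) := by
  rw [← Finset.sum_neg_distrib, Real.exp_sum,
    ENNReal.ofReal_prod_of_nonneg fun _ _ => (Real.exp_pos _).le]
  refine Finset.prod_congr rfl fun k _ => ?_
  rw [exponentialPDF_of_nonneg (hv k).le]
  simp

theorem measurable_exponentialPDF (r : ℝ) : Measurable (exponentialPDF r) :=
  (measurable_exponentialPDFReal r).ennreal_ofReal

theorem pi_expMeasure_one (n : ℕ) : (Measure.pi fun _ : Fin n => expMeasure 1) =
    (volume : Measure (Fin n → ℝ)).withDensity (fun v => ∏ k, exponentialPDF 1 (v k)) := by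
  have : IsProbabilityMeasure ((volume : Measure ℝ).withDensity (exponentialPDF 1)) :=
    isProbabilityMeasure_expMeasure_one
  change (Measure.pi fun _ : Fin n => volume.withDensity (exponentialPDF 1)) = _
  exact pi_withDensity_eq (f := exponentialPDF 1) (measurable_exponentialPDF 1)

theorem measurable_prod_exponentialPDF (n : ℕ) :
    Measurable fun v : Fin n → ℝ => ∏ k, exponentialPDF 1 (v k) :=
  Finset.measurable_fun_prod _ fun k _ =>
    (measurable_exponentialPDF 1).comp (measurable_pi_apply k)

/-- Passing from the ordered sample to its `r`-scaled spacings in the exponential case. -/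
theorem lintegral_partialSums_le {d r : ℕ} (hr : 0 < r) {H : Set (Fin (d + 1) → ℝ)}
    (hH : MeasurableSet H) :
    ENNReal.ofReal ((r : ℝ)⁻¹ ^ (d + 1)) *
      ∫⁻ e, {e : Fin (d + 1) → ℝ | (∀ k, 0 < e k) ∧ (fun k => partialSums e k / r) ∈ H}.indicator
        (fun e => ENNReal.ofReal (Real.exp (-∑ k, partialSums e k / r))) e
        ∂(Measure.pi fun _ => expMeasure 1) ≤
      ∫⁻ v in {v | StrictMono v} ∩ {v | (∀ k, 0 < v k) ∧ v ∈ H},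
        expMeasure 1 (Set.Ioi (v (Fin.last d))) ^ r ∂(Measure.pi fun _ => expMeasure 1) := by
  have hr' : (0 : ℝ) < r := Nat.cast_pos.2 hr
  have hpos : MeasurableSet {v : Fin (d + 1) → ℝ | ∀ k, 0 < v k} := by
    simp only [Set.ofPred_forall]
    exact MeasurableSet.iInter fun k => measurableSet_lt measurable_const (measurable_pi_apply k)
  have hB : MeasurableSet ({v : Fin (d + 1) → ℝ | StrictMono v} ∩
      {v | (∀ k, 0 < v k) ∧ v ∈ H}) := (measurableSet_strictMono _).inter (hpos.inter hH)
  have hps : Measurable fun (e : Fin (d + 1) → ℝ) k => partialSums e k / r :=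
    measurable_pi_lambda _ fun k =>
      ((measurable_pi_apply k).comp measurable_partialSums).div_const _
  have hmeas : Measurable fun v : Fin (d + 1) → ℝ =>
      expMeasure 1 (Set.Ioi (v (Fin.last d))) ^ r := by
    have hanti : Antitone fun t : ℝ => expMeasure 1 (Set.Ioi t) := fun s t hst =>
      measure_mono (Set.Ioi_subset_Ioi hst)
    exact (hanti.measurable.comp (measurable_pi_apply _)).pow_const r
  have hmeas2 : Measurable fun e : Fin (d + 1) → ℝ =>
      ENNReal.ofReal (Real.exp (-∑ k, partialSums e k / r)) := by
    have : Measurable fun e : Fin (d + 1) → ℝ => ∑ k, partialSums e k / r :=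
      Finset.measurable_fun_sum _ fun k _ => (measurable_pi_apply k).comp hps
    exact (Real.measurable_exp.comp this.neg).ennreal_ofReal
  have hC : MeasurableSet {e : Fin (d + 1) → ℝ |
      (∀ k, 0 < e k) ∧ (fun k => partialSums e k / r) ∈ H} := hpos.inter (hps hH)
  rw [← lintegral_indicator hB, pi_expMeasure_one,
    lintegral_withDensity_eq_lintegral_mul _ (measurable_prod_exponentialPDF _)
      (hmeas.indicator hB),
    lintegral_withDensity_eq_lintegral_mul _ (measurable_prod_exponentialPDF _)
      (hmeas2.indicator hC),
    lintegral_eq_lintegral_partialSums hr'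
      ((measurable_prod_exponentialPDF _).mul (hmeas.indicator hB))]
  gcongr with e
  simp only [Pi.mul_apply]
  by_cases he : e ∈ {e : Fin (d + 1) → ℝ | (∀ k, 0 < e k) ∧ (fun k => partialSums e k / r) ∈ H}
  · have hk : ∀ k, 0 < partialSums e k / r := fun k => div_pos (partialSums_pos he.1 k) hr'
    have hmem : (fun k => partialSums e k / r) ∈ {v : Fin (d + 1) → ℝ | StrictMono v} ∩
        {v | (∀ k, 0 < v k) ∧ v ∈ H} :=
      ⟨fun k l hkl => div_lt_div_of_pos_right (partialSums_strictMono he.1 hkl) hr', hk, he.2⟩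
    -- The survival factor `exp (-r v_last)` equals `exp (-∑ e k)`, the joint density of the
    -- spacings. The density of `v` survives as the factor `exp (-∑ v k)`.
    rw [Set.indicator_of_mem he, Set.indicator_of_mem hmem, prod_exponentialPDF_one he.1,
      prod_exponentialPDF_one hk, expMeasure_one_Ioi (hk _).le,
      ← ENNReal.ofReal_pow (Real.exp_pos _).le, ← Real.exp_nat_mul, mul_neg,
      mul_div_cancel₀ _ hr'.ne', partialSums_last, mul_comm]
  · rw [Set.indicator_of_notMem he, mul_zero]
    exact zero_le

/-- The number of placements of the minima among `r` indices balances the Jacobian of the scaling by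
`r`. -/
theorem tendsto_descFactorial_mul_inv_pow (k : ℕ) :
    Tendsto (fun r : ℕ => (r.descFactorial k : ENNReal) * ENNReal.ofReal ((r : ℝ)⁻¹ ^ k))
      atTop (𝓝 1) := by
  have hne : ∀ᶠ r : ℕ in atTop, ((r : ℝ) ^ k) ≠ 0 := by
    filter_upwards [eventually_ge_atTop 1] with r hr
    exact pow_ne_zero _ (Nat.cast_ne_zero.2 (by omega))
  have h := (Asymptotics.isEquivalent_iff_tendsto_one hne).1 (isEquivalent_descFactorial k)
  have h2 := ENNReal.tendsto_ofReal h
  rw [ENNReal.ofReal_one] at h2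
  refine h2.congr fun r => ?_
  rw [Pi.div_apply, div_eq_mul_inv, ENNReal.ofReal_mul (Nat.cast_nonneg _), ENNReal.ofReal_natCast,
    inv_pow]

theorem expMeasure_one_pi_ae_pos (n : ℕ) :
    ∀ᵐ e ∂(Measure.pi fun _ : Fin n => expMeasure 1), ∀ k, 0 < e k :=
  ae_all_iff.2 fun k =>
    (measurePreserving_eval (fun _ : Fin n => expMeasure 1) k).quasiMeasurePreserving.ae
      expMeasure_one_ae_pos

/-! ### Fatou's lemma and the portmanteau lower bound -/

/-- The lower bound of the portmanteau theorem for the first `d + 1` coordinates, for a sample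
obtained from i.i.d. standard exponential variables by a transformation which is monotone
on `(0, ∞)`. -/
theorem measure_isOpen_le_liminf_of_monotoneOn {Q : ℝ → ℝ} (hQ : Measurable Q)
    (hQmono : MonotoneOn Q (Set.Ioi 0)) {a b : ℕ → ℝ} {g : ℝ → ℝ}
    (hlim : ∀ w, 0 < w → Tendsto (fun r : ℕ => (Q (w / r) + b r) / a r) atTop (𝓝 (g w)))
    (hg : Measurable g) {d : ℕ} {G : Set (Fin (d + 1) → ℝ)} (hG : IsOpen G) :
    (Measure.pi fun _ => expMeasure 1) {e | (fun k => g (partialSums e k)) ∈ G} ≤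
      liminf (fun r : ℕ => Measure.infinitePi (fun _ : ℕ => expMeasure 1)
        {u | (fun j : Fin (d + 1) =>
          (rthLargest (fun i => Q (u i)) r (r + j) + b r) / a r) ∈ G}) atTop := by
  let H : ℕ → Set (Fin (d + 1) → ℝ) := fun r => {v | (fun k => (Q (v k) + b r) / a r) ∈ G}
  have hH : ∀ r, MeasurableSet (H r) := fun r =>
    (measurable_pi_lambda _ fun k => ((hQ.comp (measurable_pi_apply k)).add_const _).div_const _ :
      Measurable fun (v : Fin (d + 1) → ℝ) k => (Q (v k) + b r) / a r) hG.measurableSet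
  have hpos : MeasurableSet {v : Fin (d + 1) → ℝ | ∀ k, 0 < v k} := by
    simp only [Set.ofPred_forall]
    exact MeasurableSet.iInter fun k => measurableSet_lt measurable_const (measurable_pi_apply k)
  have hps : ∀ r : ℕ, Measurable fun (e : Fin (d + 1) → ℝ) k => partialSums e k / r := fun r =>
    measurable_pi_lambda _ fun k =>
      ((measurable_pi_apply k).comp measurable_partialSums).div_const _
  let c : ℕ → ENNReal := fun r =>
    (r.descFactorial (d + 1) : ENNReal) * ENNReal.ofReal ((r : ℝ)⁻¹ ^ (d + 1))
  let f : ℕ → (Fin (d + 1) → ℝ) → ENNReal := fun r =>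
    {e : Fin (d + 1) → ℝ | (∀ k, 0 < e k) ∧ (fun k => partialSums e k / r) ∈ H r}.indicator
      (fun e => ENNReal.ofReal (Real.exp (-∑ k, partialSums e k / r)))
  have hf : ∀ r, Measurable (f r) := by
    intro r
    have : Measurable fun e : Fin (d + 1) → ℝ => ∑ k, partialSums e k / r :=
      Finset.measurable_fun_sum _ fun k _ => (measurable_pi_apply k).comp (hps r)
    exact (Real.measurable_exp.comp this.neg).ennreal_ofReal.indicator
      (hpos.inter (hps r (hH r)))
  have hS : MeasurableSet {e : Fin (d + 1) → ℝ | (fun k => g (partialSums e k)) ∈ G} :=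
    (measurable_pi_lambda _ fun k => hg.comp ((measurable_pi_apply k).comp measurable_partialSums) :
      Measurable fun (e : Fin (d + 1) → ℝ) k => g (partialSums e k)) hG.measurableSet
  have hlower : ∀ r, 1 ≤ r → ∫⁻ e, c r * f r e ∂(Measure.pi fun _ => expMeasure 1) ≤
      Measure.infinitePi (fun _ : ℕ => expMeasure 1) {u | (fun j : Fin (d + 1) =>
          (rthLargest (fun i => Q (u i)) r (r + j) + b r) / a r) ∈ G} := by
    intro r hr
    rw [lintegral_const_mul _ (hf r), mul_assoc]
    refine (mul_le_mul_right (lintegral_partialSums_le hr (hH r)) _).trans ?_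
    refine (descFactorial_mul_lintegral_le r (hpos.inter (hH r))).trans (measure_mono ?_)
    rintro u ⟨s, hs, hsr, hsm, hup, huH⟩
    have hval : ∀ j : Fin (d + 1), rthLargest (fun i => Q (u i)) r (r + j) = Q (u (s j)) := by
      refine rthLargest_eq_of_smallest hs hsr ?_ ?_
      · intro k l hkl
        exact hQmono (hup k) (hup l) (hsm.1.monotone hkl)
      · intro m hm hms
        have hlt := hsm.2 m hm hms
        -- Positivity of `u m` is inherited from the smaller value at `s (Fin.last d)`, so
        -- monotonicity of `Q` on `(0, ∞)` applies.
        exact hQmono (hup _) ((hup (Fin.last d)).trans hlt) hlt.le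
    simp only [Set.mem_ofPred_eq, hval]
    exact huH
  calc (Measure.pi fun _ => expMeasure 1) {e | (fun k => g (partialSums e k)) ∈ G}
      = ∫⁻ e, {e | (fun k => g (partialSums e k)) ∈ G}.indicator 1 e
          ∂(Measure.pi fun _ => expMeasure 1) := (lintegral_indicator_one hS).symm
    _ ≤ ∫⁻ e, liminf (fun r => c r * f r e) atTop ∂(Measure.pi fun _ => expMeasure 1) := by
        refine lintegral_mono_ae ?_
        filter_upwards [expMeasure_one_pi_ae_pos (d + 1)] with e he
        by_cases heS : e ∈ {e : Fin (d + 1) → ℝ | (fun k => g (partialSums e k)) ∈ G}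
        · rw [Set.indicator_of_mem heS, Pi.one_apply]
          have htend : Tendsto (fun (r : ℕ) k => (Q (partialSums e k / r) + b r) / a r) atTop
              (𝓝 fun k => g (partialSums e k)) :=
            tendsto_pi_nhds.2 fun k => hlim _ (partialSums_pos he k)
          have hsum : Tendsto (fun r : ℕ => -∑ k, partialSums e k / (r : ℝ)) atTop (𝓝 0) := by
            simpa using (tendsto_finsetSum Finset.univ fun k _ =>
              tendsto_const_div_atTop_nhds_zero_nat (partialSums e k)).neg
          have hexp := ENNReal.tendsto_ofReal ((Real.continuous_exp.tendsto 0).comp hsum)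
          rw [Real.exp_zero, ENNReal.ofReal_one] at hexp
          have hprod := ENNReal.Tendsto.mul (tendsto_descFactorial_mul_inv_pow (d + 1))
            (Or.inl one_ne_zero) hexp (Or.inl one_ne_zero)
          rw [one_mul] at hprod
          refine (Tendsto.liminf_eq (hprod.congr' ?_)).ge
          -- Openness of `G` makes the indicator eventually `1` at this `e`, so the integrand tends
          -- to `1`.
          filter_upwards [htend.eventually (hG.mem_nhds heS)] with r hr
          have hmem : e ∈ {e : Fin (d + 1) → ℝ | (∀ k, 0 < e k) ∧
              (fun k => partialSums e k / r) ∈ H r} := ⟨he, hr⟩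
          simp only [c, f, Set.indicator_of_mem hmem, Function.comp_apply]
        · rw [Set.indicator_of_notMem heS]
          exact zero_le
    _ ≤ liminf (fun r => ∫⁻ e, c r * f r e ∂(Measure.pi fun _ => expMeasure 1)) atTop :=
        lintegral_liminf_le fun r => (hf r).const_mul _
    _ ≤ _ := by
        refine liminf_le_liminf ?_
        filter_upwards [eventually_ge_atTop 1] with r hr using hlower r hr

/-! ### From finitely many coordinates to the sequence space -/

theorem exists_isOpen_iUnion_cylinder {G : Set (ℕ → ℝ)} (hG : IsOpen G) :
    ∃ V : (d : ℕ) → Set (Fin (d + 1) → ℝ), (∀ d, IsOpen (V d)) ∧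
      Monotone (fun d => {z : ℕ → ℝ | (fun k : Fin (d + 1) => z k) ∈ V d}) ∧
      G = ⋃ d, {z : ℕ → ℝ | (fun k : Fin (d + 1) => z k) ∈ V d} := by
  -- The interior of the set of prefixes all of whose extensions lie in `G`.
  let V : (d : ℕ) → Set (Fin (d + 1) → ℝ) := fun d =>
    interior {v | ∀ z : ℕ → ℝ, (fun k : Fin (d + 1) => z k) = v → z ∈ G}
  refine ⟨V, fun d => isOpen_interior, ?_, ?_⟩
  · intro d d' hd z hz
    let ρ : (Fin (d' + 1) → ℝ) → Fin (d + 1) → ℝ := fun v k => v (Fin.castLE (by omega) k)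
    have hρ : Continuous ρ := continuous_pi fun k => continuous_apply _
    refine mem_interior.2 ⟨ρ ⁻¹' V d, ?_, isOpen_interior.preimage hρ, hz⟩
    rintro v hv y rfl
    exact interior_subset hv y rfl
  · refine Set.Subset.antisymm (fun z hz => ?_) (Set.iUnion_subset fun d z hz => ?_)
    · obtain ⟨I, u, hu, hsub⟩ := isOpen_pi_iff.1 hG z hz
      refine Set.mem_iUnion.2 ⟨I.sup id, mem_interior.2
        ⟨⋂ k : Fin (I.sup id + 1), ⋂ _ : (k : ℕ) ∈ I, {v | v k ∈ u k}, ?_, ?_, ?_⟩⟩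
      · rintro v hv y rfl
        refine hsub fun i hi => ?_
        simp only [Set.mem_iInter] at hv
        exact hv ⟨i, Nat.lt_succ_of_le (Finset.le_sup (f := id) hi)⟩ hi
      · exact isOpen_iInter_of_finite fun k => isOpen_iInter_of_finite fun hk =>
          (hu _ hk).1.preimage (continuous_apply k)
      · simp only [Set.mem_iInter]
        exact fun k hk => (hu _ hk).2
    · exact interior_subset hz z rfl

theorem mainTheorem2
    {Ω Ω' : Type*} [MeasurableSpace Ω] [MeasurableSpace Ω']
    (P : Measure Ω) [IsProbabilityMeasure P] (P' : Measure Ω') [IsProbabilityMeasure P']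
    -- an i.i.d. sequence with common law `μ`, whose distribution function is continuous
    (X : ℕ → Ω → ℝ) (μ : Measure ℝ) [IsProbabilityMeasure μ]
    (hXindep : iIndepFun X P) (hXlaw : ∀ i, HasLaw (X i) μ P)
    (hF : Continuous (cdf μ))
    -- the minimum domain of attraction condition
    (γ : ℝ) (a b : ℕ → ℝ) (ha : ∀ r, 1 ≤ r → 0 < a r)
    (hR : ∀ x ∈ suppGamma γ,
      Tendsto (fun r : ℕ => (r : EReal) * cumHazard (cdf μ) (a r * x - b r)) atTop
        (𝓝 ((gGamma γ x : ℝ) : EReal)))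
    -- i.i.d. standard exponential spacings
    (E : ℕ → Ω' → ℝ) (hEindep : iIndepFun E P')
    (hElaw : ∀ i, HasLaw (E i) (expMeasure 1) P') :
    TendstoInDistribution
      (fun (r : ℕ) (ω : Ω) (j : ℕ) => (rthLargest (fun i => X i ω) r (r + j) + b r) / a r)
      atTop
      (fun (ω' : Ω') (j : ℕ) => gGammaInv γ (arrival E (j + 1) ω'))
      (fun _ => P) P' := by
  have hEae : AEMeasurable (fun ω' (i : ℕ) => E i ω') P' :=
    aemeasurable_pi_iff.2 fun i => (hElaw i).aemeasurable
  have hXae : AEMeasurable (fun ω (i : ℕ) => X i ω) P :=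
    aemeasurable_pi_iff.2 fun i => (hXlaw i).aemeasurable
  have hQ := measurable_hazardQuantile μ
  have hlawX : P.map (fun ω (i : ℕ) => X i ω) =
      (Measure.infinitePi fun _ : ℕ => expMeasure 1).map
        (fun u i => hazardQuantile μ (u i)) := by
    rw [(hXindep.hasLaw_infinitePi hXlaw hXae).map_eq, Measure.infinitePi_map_pi _ fun _ => hQ]
    simp_rw [map_hazardQuantile μ]
  let W : ℕ → (ℕ → ℝ) → ℕ → ℝ := fun r x j => (rthLargest x r (r + j) + b r) / a r
  have hW : ∀ r, Measurable (W r) := fun r => measurable_pi_lambda _ fun j =>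
    ((measurable_rthLargest r (r + j)).add_const _).div_const _
  have hWX : ∀ r, AEMeasurable (fun ω => W r fun i => X i ω) P := fun r =>
    (hW r).comp_aemeasurable hXae
  have hZ : AEMeasurable (fun ω' (j : ℕ) => gGammaInv γ (arrival E (j + 1) ω')) P' := by
    refine aemeasurable_pi_iff.2 fun j => (measurable_gGammaInv γ).comp_aemeasurable ?_
    exact Finset.aemeasurable_fun_sum _ fun i _ => (hElaw i).aemeasurable
  refine ⟨hWX, hZ, tendsto_of_forall_isOpen_le_liminf' fun G hG => ?_⟩
  obtain ⟨V, hV, hVmono, hVG⟩ := exists_isOpen_iUnion_cylinder hG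
  have hVm : ∀ d, MeasurableSet {z : ℕ → ℝ | (fun k : Fin (d + 1) => z k) ∈ V d} := fun d =>
    (measurable_pi_lambda _ fun k => measurable_pi_apply _ :
      Measurable fun (z : ℕ → ℝ) (k : Fin (d + 1)) => z k) (hV d).measurableSet
  change P'.map (fun ω' (j : ℕ) => gGammaInv γ (arrival E (j + 1) ω')) G ≤
    liminf (fun r => P.map (fun ω => W r fun i => X i ω) G) atTop
  -- Continuity from below reduces the claim to one cylinder. On the sample side the cylinder is
  -- enlarged back to `G` at the end.
  conv_lhs => rw [hVG, hVmono.measure_iUnion]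
  refine iSup_le fun d => ?_
  have hlawE : HasLaw (fun ω' (k : Fin (d + 1)) => E k ω')
      (Measure.pi fun _ => expMeasure 1) P' :=
    iIndepFun.hasLaw_pi (fun k : Fin (d + 1) => hElaw k) (hEindep.precomp Fin.val_injective)
  have hS : MeasurableSet
      {e : Fin (d + 1) → ℝ | (fun k => gGammaInv γ (partialSums e k)) ∈ V d} :=
    (measurable_pi_lambda _ fun k =>
      (measurable_gGammaInv γ).comp ((measurable_pi_apply k).comp measurable_partialSums) :
      Measurable fun (e : Fin (d + 1) → ℝ) k => gGammaInv γ (partialSums e k))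
        (hV d).measurableSet
  have harr : ∀ ω' (k : Fin (d + 1)),
      arrival E (k + 1) ω' = partialSums (fun i : Fin (d + 1) => E i ω') k := by
    intro ω' k
    unfold arrival partialSums
    refine (Finset.sum_nbij (fun i : Fin (d + 1) => (i : ℕ)) ?_ ?_ ?_ fun _ _ => rfl).symm
    · intro i hi
      have hik : i ≤ k := Finset.mem_Iic.1 hi
      exact Finset.mem_range.2 (Nat.lt_succ_of_le hik)
    · exact fun i _ j _ h => Fin.val_injective h
    · intro i hi
      have hik : i < k + 1 := Finset.mem_range.1 (Finset.mem_coe.1 hi)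
      exact ⟨⟨i, by omega⟩, Finset.mem_coe.2 (Finset.mem_Iic.2 (Nat.le_of_lt_succ hik)), rfl⟩
  calc P'.map (fun ω' (j : ℕ) => gGammaInv γ (arrival E (j + 1) ω'))
        {z : ℕ → ℝ | (fun k : Fin (d + 1) => z k) ∈ V d}
      = (Measure.pi fun _ => expMeasure 1)
          {e : Fin (d + 1) → ℝ | (fun k => gGammaInv γ (partialSums e k)) ∈ V d} := by
        rw [Measure.map_apply_of_aemeasurable hZ (hVm d), ← hlawE.map_eq,
          Measure.map_apply_of_aemeasurable hlawE.aemeasurable hS]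
        simp only [Set.preimage_ofPred_eq, harr]
    _ ≤ _ := measure_isOpen_le_liminf_of_monotoneOn hQ (hazardQuantile_monotoneOn μ)
        (fun w hw => tendsto_hazardQuantile_rescaled μ ha hR hw) (measurable_gGammaInv γ) (hV d)
    _ ≤ _ := by
        refine liminf_le_liminf (Eventually.of_forall fun r => ?_)
        have hmap : P.map (fun ω => W r fun i => X i ω) =
            (Measure.infinitePi fun _ : ℕ => expMeasure 1).map
              (fun u => W r fun i => hazardQuantile μ (u i)) := by
          have hQm : Measurable fun (u : ℕ → ℝ) (i : ℕ) => hazardQuantile μ (u i) :=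
            measurable_pi_lambda _ fun i => hQ.comp (measurable_pi_apply i)
          have h1 := AEMeasurable.map_map_of_aemeasurable (hW r).aemeasurable hXae
          rw [hlawX, Measure.map_map (hW r) hQm] at h1
          exact h1.symm
        have hsub : {z : ℕ → ℝ | (fun k : Fin (d + 1) => z k) ∈ V d} ⊆ G := by
          rw [hVG]
          exact Set.subset_iUnion (fun d => {z : ℕ → ℝ | (fun k : Fin (d + 1) => z k) ∈ V d}) d
        have hWm : Measurable fun u : ℕ → ℝ => W r fun i => hazardQuantile μ (u i) :=
          (hW r).comp (measurable_pi_lambda _ fun i => hQ.comp (measurable_pi_apply i))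
        rw [hmap, Measure.map_apply hWm hG.measurableSet]
        exact measure_mono fun u hu => hsub hu
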